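/- Let $A$ be a finite or countable set with the discrete topology, let $\sigma$ be the left shift $(\sigma x)_n=x_{n+1}$ on $A^{\mathbb Z}$ (product topology), and let $X\subset A^{\mathbb Z}$ be a two-sided shift space, i.e. a closed set with $\sigma(X)=X$. Let $\mathcal L$ be the language of $X$, the set of all finite words (including the empty word) that appear in some $x\in X$. Suppose that $X$ is transitive (for all $u,w\in\mathcal L$ there is $z\in\mathcal L$ with $uzw\in\mathcal L$), and that $v\in\mathcal L$ is a synchronizing word (for all $u,w\in\mathcal L$ with $uv\in\mathcal L$ and $vw\in\mathcal L$ one has $uvw\in\mathcal L$). Let $r\colon X\to(0,\infty)$ have the Walters property: for every $\varepsilon>0$ there is an integer $k\ge 0$ such that for every $n\in\mathbb N$ and all $x,y\in X$ with $x_i=y_i$ for $-k\le i\le n+k$, $$\Bigl|\sum_{j=0}^{n-1}\bigl(r(\sigma^jx)-r(\sigma^jy)\bigr)\Bigr|<\varepsilon .$$ Let $M_r$ be the quotient space of $X\times\mathbb R$ by the equivalence relation generated by $(x,s+r(x))\sim(\sigma x,s)$, and let the suspension flow $\varphi^t\colon M_r\to M_r$ be induced by the vertical flow $(x,s)\mapsto(x,s+t)$.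 Call $\varphi^t$ topologically mixing if for all nonempty open $U,V\subset M_r$ there is $T\in\mathbb R$ with $\varphi^t(U)\cap V\neq\emptyset$ for all $t\ge T$. Let $[v]$ be the cylinder of all $x\in X$ with $x_{[-n,n]}=v$ if $|v|=2n+1$, and with $x_{[-n,n)}=v$ if $|v|=2n$. Then $\varphi^t$ is not topologically mixing if and only if there exists $\delta>0$ such that for every $\sigma$-periodic point $p\in[v]$, $$\sum_{j=0}^{\operatorname{per}(p)-1}r(\sigma^jp)\in\delta\mathbb Z,$$ where $\operatorname{per}(p)$ is the (least) period of $p$ under $\sigma$. -/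

import Mathlib

namespace ShiftSuspension

open SymbolicDynamics.FullShift

section Symbolic

variable {A : Type*} [TopologicalSpace A]

/-- The left shift `(σ x)ₙ = xₙ₊₁` on a two-sided shift space `X ⊆ A^ℤ`
(a closed subset of `A^ℤ`, invariant under all powers of the shift). -/
def shiftMap (X : Subshift A ℤ) : X.carrier → X.carrier :=
  fun x => ⟨shift (1 : ℤ) x.1, X.mapsTo 1 x.2⟩

theorem shiftMap_apply (X : Subshift A ℤ) (x : X.carrier) (n : ℤ) :
    (shiftMap X x).1 n = x.1 (n + 1) := by
  change x.1 (1 + n) = x.1 (n + 1)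
  rw [add_comm]

theorem shiftMap_bijective (X : Subshift A ℤ) : Function.Bijective (shiftMap X) := by
  constructor
  · intro x y h
    apply Subtype.ext
    funext n
    have := congrArg (fun z : X.carrier => z.1 (n - 1)) h
    simpa [shiftMap_apply] using this
  · intro x
    refine ⟨⟨shift (-1 : ℤ) x.1, X.mapsTo (-1) x.2⟩, ?_⟩
    apply Subtype.ext
    funext n
    rw [shiftMap_apply]
    exact congrArg x.1 (show (-1 : ℤ) + (n + 1) = n by ring)

/-- The word `w` occurs in the bi-infinite sequence `x` with its first letter at position `i`. -/
def OccursAt (x : ℤ → A) (i : ℤ) (w : List A) : Prop :=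
  ∀ j : Fin w.length, x (i + (j : ℤ)) = w.get j

/-- The language of `X`: all finite words (the empty one included) that appear in a point of `X`. -/
def language (X : Subshift A ℤ) : Set (List A) :=
  {w | ∃ x ∈ X.carrier, ∃ i : ℤ, OccursAt x i w}

/-- Transitivity, in terms of the language. -/
def IsTransitive (X : Subshift A ℤ) : Prop :=
  ∀ u ∈ language X, ∀ v ∈ language X, ∃ w ∈ language X, u ++ w ++ v ∈ language X

/-- `v` is a synchronizing word of `X`: a word of the language such that `uvw` is in the language
whenever `uv` and `vw` are. -/
def IsSynchronizing (X : Subshift A ℤ) (v : List A) : Prop :=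
  v ∈ language X ∧ ∀ u ∈ language X, ∀ w ∈ language X,
    u ++ v ∈ language X → v ++ w ∈ language X → u ++ v ++ w ∈ language X

/-- The centred two-sided cylinder `[w]`: the word `w` sits on the positions `[-n, n]` if
`|w| = 2n+1`, and on the positions `[-n, n)` if `|w| = 2n`. -/
def cylinder (X : Subshift A ℤ) (w : List A) : Set X.carrier :=
  {x | OccursAt x.1 (-((w.length / 2 : ℕ) : ℤ)) w}

/-- The Walters property of a function on a shift space. -/
def HasWaltersProperty (X : Subshift A ℤ) (r : X.carrier → ℝ) : Prop :=
  ∀ ε : ℝ, 0 < ε → ∃ k : ℕ, ∀ (n : ℕ) (x y : X.carrier),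
    (∀ i : ℤ, -(k : ℤ) ≤ i → i ≤ (n : ℤ) + (k : ℤ) → x.1 i = y.1 i) →
      |∑ j ∈ Finset.range n, (r ((shiftMap X)^[j] x) - r ((shiftMap X)^[j] y))| < ε

end Symbolic

section Suspension

variable {Y : Type*}

/-- The generating identification `(y, s + r y) ∼ (f y, s)` on `Y × ℝ`. -/
def SuspensionRel (f : Y → Y) (r : Y → ℝ) (p q : Y × ℝ) : Prop :=
  q.1 = f p.1 ∧ p.2 = q.2 + r p.1

/-- The phase space of the suspension of `f` with roof function `r`: the quotient of `Y × ℝ` by the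
equivalence relation generated by `(y, s + r y) ∼ (f y, s)`. See `exists_unique_strip` for the
description as a quotient of the region `0 ≤ s ≤ r y`. -/
def SuspensionSpace (f : Y → Y) (r : Y → ℝ) : Type _ := Quot (SuspensionRel f r)

/-- The phase space carries the quotient of the product topology. -/
instance [TopologicalSpace Y] (f : Y → Y) (r : Y → ℝ) : TopologicalSpace (SuspensionSpace f r) :=
  inferInstanceAs (TopologicalSpace (Quot (SuspensionRel f r)))

/-- The class of `(y, s)` in the phase space. -/
def SuspensionSpace.mk (f : Y → Y) (r : Y → ℝ) (p : Y × ℝ) : SuspensionSpace f r :=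
  Quot.mk _ p

/-- The suspension flow: the quotient of the vertical flow `(y, s) ↦ (y, s + t)` on `Y × ℝ`. -/
def suspensionFlow (f : Y → Y) (r : Y → ℝ) (t : ℝ) : SuspensionSpace f r → SuspensionSpace f r :=
  Quot.map (fun p => (p.1, p.2 + t)) (by
    rintro p q ⟨h₁, h₂⟩
    refine ⟨h₁, ?_⟩
    simp only [h₂]
    ring)

theorem suspensionFlow_zero (f : Y → Y) (r : Y → ℝ) (P : SuspensionSpace f r) :
    suspensionFlow f r 0 P = P := by
  induction P using Quot.ind with
  | mk p => exact congrArg (SuspensionSpace.mk f r) (by simp)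

theorem suspensionFlow_add (f : Y → Y) (r : Y → ℝ) (t t' : ℝ) (P : SuspensionSpace f r) :
    suspensionFlow f r (t + t') P = suspensionFlow f r t (suspensionFlow f r t' P) := by
  induction P using Quot.ind with
  | mk p => exact congrArg (SuspensionSpace.mk f r) (by simp; ring)

theorem mk_add_birkhoffSum (f : Y → Y) (r : Y → ℝ) (n : ℕ) (y : Y) (s : ℝ) :
    SuspensionSpace.mk f r (y, s + birkhoffSum f r n y) = SuspensionSpace.mk f r (f^[n] y, s) := by
  induction n generalizing s with
  | zero => simp
  | succ n ih =>
    have h : SuspensionSpace.mk f r (f^[n] y, s + r (f^[n] y)) =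
        SuspensionSpace.mk f r (f (f^[n] y), s) :=
      Quot.sound ⟨rfl, rfl⟩
    rw [birkhoffSum_succ, Function.iterate_succ_apply', ← h]
    rw [show s + (birkhoffSum f r n y + r (f^[n] y))
      = (s + r (f^[n] y)) + birkhoffSum f r n y by ring]
    exact ih _

/-- The usual formula: `φ^T(y, s) = (fⁿ y, s')` when `∑_{j<n} r(f^j y) + s' = T + s`. -/
theorem suspensionFlow_mk (f : Y → Y) (r : Y → ℝ) (T s s' : ℝ) (n : ℕ) (y : Y)
    (h : birkhoffSum f r n y + s' = T + s) :
    suspensionFlow f r T (SuspensionSpace.mk f r (y, s)) = SuspensionSpace.mk f r (f^[n] y, s') := by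
  rw [← mk_add_birkhoffSum]
  exact congrArg (fun a => SuspensionSpace.mk f r (y, a)) (by linarith)

theorem mk_eq_mk_iff (f : Y → Y) (r : Y → ℝ) (p q : Y × ℝ) :
    SuspensionSpace.mk f r p = SuspensionSpace.mk f r q ↔
      ∃ m n : ℕ, f^[m] p.1 = f^[n] q.1 ∧
        p.2 - birkhoffSum f r m p.1 = q.2 - birkhoffSum f r n q.1 := by
  constructor
  · intro h
    have h' := Quot.eqvGen_exact h
    clear h
    induction h' with
    | rel p q h => exact ⟨1, 0, by simp [h.1], by simp [h.2]⟩
    | refl p => exact ⟨0, 0, rfl, rfl⟩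
    | symm p q _ ih =>
      obtain ⟨m, n, h₁, h₂⟩ := ih
      exact ⟨n, m, h₁.symm, h₂.symm⟩
    | trans p q o _ _ ih ih' =>
      obtain ⟨m, n, h₁, h₂⟩ := ih
      obtain ⟨k, l, h₃, h₄⟩ := ih'
      refine ⟨k + m, n + l, ?_, ?_⟩
      · rw [Function.iterate_add_apply, h₁, ← Function.iterate_add_apply, Nat.add_comm,
          Function.iterate_add_apply, h₃, ← Function.iterate_add_apply]
      · have e₁ := birkhoffSum_add f r m k p.1
        have e₂ := birkhoffSum_add f r n k q.1
        have e₃ := birkhoffSum_add f r k n q.1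
        have e₄ := birkhoffSum_add f r l n o.1
        rw [h₁] at e₁
        rw [h₃] at e₃
        rw [Nat.add_comm k m, Nat.add_comm n l]
        rw [Nat.add_comm k n] at e₃
        linarith
  · rintro ⟨m, n, h₁, h₂⟩
    have e₁ := mk_add_birkhoffSum f r m p.1 (p.2 - birkhoffSum f r m p.1)
    have e₂ := mk_add_birkhoffSum f r n q.1 (q.2 - birkhoffSum f r n q.1)
    rw [sub_add_cancel] at e₁ e₂
    calc SuspensionSpace.mk f r p = SuspensionSpace.mk f r (f^[m] p.1, _) := e₁
      _ = SuspensionSpace.mk f r (f^[n] q.1, _) := by rw [h₁, h₂]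
      _ = SuspensionSpace.mk f r q := e₂.symm

/-- For a bijection `f` and a positive roof function with divergent forward and backward Birkhoff
sums (for instance one bounded away from `0`), every point of the phase space has exactly one
representative `(y, s)` with `0 ≤ s < r y`. -/
theorem exists_unique_strip (f : Y → Y) (hf : Function.Bijective f) (r : Y → ℝ)
    (hr : ∀ y, 0 < r y) (hfwd : ∀ y (c : ℝ), ∃ n, c < birkhoffSum f r n y)
    (hbwd : ∀ y (c : ℝ), ∃ n z, f^[n] z = y ∧ c < birkhoffSum f r n z)
    (P : SuspensionSpace f r) :
    ∃! p : Y × ℝ, (0 ≤ p.2 ∧ p.2 < r p.1) ∧ SuspensionSpace.mk f r p = P := by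
  have key : ∀ (y z : Y) (s s' : ℝ) (k : ℕ), 0 ≤ s' → s < r y → f^[k] y = z →
      s - birkhoffSum f r k y = s' → k = 0 := by
    intro y z s s' k h0 h1 _ h3
    by_contra hk
    obtain ⟨j, rfl⟩ := Nat.exists_eq_succ_of_ne_zero hk
    rw [birkhoffSum_succ'] at h3
    have : 0 ≤ birkhoffSum f r j (f y) := Finset.sum_nonneg fun i _ => (hr _).le
    linarith
  have key2 : ∀ (p q : Y × ℝ) (m n : ℕ), m ≤ n → (0 ≤ p.2 ∧ p.2 < r p.1) →
      (0 ≤ q.2 ∧ q.2 < r q.1) → f^[m] p.1 = f^[n] q.1 →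
      p.2 - birkhoffSum f r m p.1 = q.2 - birkhoffSum f r n q.1 → p = q := by
    intro p q m n hmn hp hq h₁ h₂
    obtain ⟨k, rfl⟩ := Nat.exists_eq_add_of_le hmn
    rw [Nat.add_comm m k] at h₁ h₂
    rw [Nat.add_comm k m, Function.iterate_add_apply] at h₁
    have e := (hf.1.iterate m) h₁
    rw [birkhoffSum_add, ← e] at h₂
    have hk := key q.1 p.1 q.2 p.2 k hp.1 hq.2 e.symm (by linarith)
    subst hk
    simp at e h₂
    exact Prod.ext e h₂
  obtain ⟨⟨y, s⟩, rfl⟩ := Quot.exists_rep P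
  change ∃! p : Y × ℝ, (0 ≤ p.2 ∧ p.2 < r p.1) ∧
    SuspensionSpace.mk f r p = SuspensionSpace.mk f r (y, s)
  have hex : ∃ (z : Y) (a : ℝ), 0 ≤ a ∧
      SuspensionSpace.mk f r (z, a) = SuspensionSpace.mk f r (y, s) := by
    obtain ⟨n, z, hz, hc⟩ := hbwd y (-s)
    exact ⟨z, s + birkhoffSum f r n z, by linarith, by rw [mk_add_birkhoffSum, hz]⟩
  obtain ⟨z, a, ha, hza⟩ := hex
  have hP := hfwd z a
  classical
  have hn := Nat.find_spec hP
  have hmin := fun m => Nat.find_min (H := hP) (m := m)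
  obtain ⟨j, hj⟩ : ∃ j, Nat.find hP = j + 1 := by
    apply Nat.exists_eq_succ_of_ne_zero
    intro h0
    rw [h0, birkhoffSum_zero] at hn
    linarith
  rw [hj, birkhoffSum_succ] at hn
  have hj' := not_lt.1 (hmin j (by omega))
  refine ⟨(f^[j] z, a - birkhoffSum f r j z), ⟨⟨by simp; linarith, by simp; linarith⟩, ?_⟩, ?_⟩
  · rw [← mk_add_birkhoffSum, sub_add_cancel, hza]
  · rintro q ⟨hq, hqe⟩
    have hw : SuspensionSpace.mk f r q =
        SuspensionSpace.mk f r (f^[j] z, a - birkhoffSum f r j z) := by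
      rw [← mk_add_birkhoffSum, sub_add_cancel, hza, hqe]
    obtain ⟨m, n, h₁, h₂⟩ := (mk_eq_mk_iff f r _ _).1 hw
    have hstrip : (0 ≤ (f^[j] z, a - birkhoffSum f r j z).2 ∧
      (f^[j] z, a - birkhoffSum f r j z).2 < r (f^[j] z, a - birkhoffSum f r j z).1) :=
      ⟨by simp; linarith, by simp; linarith⟩
    rcases le_total m n with h | h
    · exact key2 _ _ m n h hq hstrip h₁ h₂
    · exact (key2 _ _ n m h hstrip hq h₁.symm h₂.symm).symm

end Suspension

/-- Topological mixing of a one-parameter family of self-maps of a topological space: for all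
nonempty open `U, V` the image `φ^t(U)` meets `V` for all sufficiently large `t`. -/
def IsTopologicallyMixing {M : Type*} [TopologicalSpace M] (φ : ℝ → M → M) : Prop :=
  ∀ U V : Set M, IsOpen U → IsOpen V → U.Nonempty → V.Nonempty →
    ∃ T : ℝ, ∀ t : ℝ, T ≤ t → ((φ t '' U) ∩ V).Nonempty

end ShiftSuspension

/-! Fix a periodic point `p` in `[v]` and consider the Birkhoff sums of `r` along orbit segments
that start and end near `p`. Synchronization lets such closed paths be concatenated (`exists_glue`),
and the Walters property makes their lengths additive up to an error independent of how long they
are (`IsPath.exists_concat`). The lengths form only an approximate semigroup, but the limits of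
their differences form a subgroup `returnDifferences` of the reals, which is dense or cyclic.

If it is dense, mixing a bounded number of copies of two closed paths of almost equal length with
many turns along `p` approximates every large time (`exists_isPath_near_of_dense`), and transitivity
turns this into mixing. If it is cyclic, its generator yields `δ`, because inserting one extra
period of a periodic `q` in `[v]` into a closed path changes the length by the sum over that period
(`birkhoffSum_mem_returnDifferences`).

Conversely, mixing forces a small flow box over `[v]` to return at a time `jδ + δ/2`. The closing
lemma `exists_periodic_of_agree` shadows this return by a periodic point whose sum is too far from
`δℤ`. -/

namespace ShiftSuspension

open SymbolicDynamics.FullShift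

/-! ### Words occurring in sequences -/

section Words

variable {A : Type*}

theorem occursAt_iff_getElem (x : ℤ → A) (i : ℤ) (w : List A) :
    OccursAt x i w ↔ ∀ (j : ℕ) (h : j < w.length), x (i + j) = w[j] :=
  ⟨fun hw j h => hw ⟨j, h⟩, fun hw j => hw j.1 j.2⟩

theorem occursAt_append (x : ℤ → A) (i : ℤ) (u w : List A) :
    OccursAt x i (u ++ w) ↔ OccursAt x i u ∧ OccursAt x (i + u.length) w := by
  simp only [occursAt_iff_getElem]
  constructor
  · intro h
    constructor
    · intro j hj
      rw [h j (by simp; omega), List.getElem_append_left hj]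
    · intro j hj
      have := h (u.length + j) (by simp; omega)
      rw [List.getElem_append_right (by omega)] at this
      simp only [Nat.add_sub_cancel_left] at this
      rw [← this]
      push_cast
      rw [add_assoc]
  · rintro ⟨h₁, h₂⟩ j hj
    by_cases hju : j < u.length
    · rw [List.getElem_append_left hju, h₁ j hju]
    · rw [List.getElem_append_right (by omega), ← h₂ (j - u.length) (by simp at hj; omega)]
      congr 1
      omega

/-- The word of length `n` read in `x` from position `i` on. -/
def wordAt (x : ℤ → A) (i : ℤ) (n : ℕ) : List A :=
  List.ofFn fun j : Fin n => x (i + (j : ℕ))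

@[simp]
theorem length_wordAt (x : ℤ → A) (i : ℤ) (n : ℕ) : (wordAt x i n).length = n := by
  simp [wordAt]

theorem occursAt_wordAt (x y : ℤ → A) (i i' : ℤ) (n : ℕ) :
    OccursAt y i' (wordAt x i n) ↔ ∀ j : ℕ, j < n → y (i' + j) = x (i + j) := by
  rw [occursAt_iff_getElem]
  simp [wordAt]

theorem occursAt_wordAt_self (x : ℤ → A) (i : ℤ) (n : ℕ) : OccursAt x i (wordAt x i n) :=
  (occursAt_wordAt x x i i n).2 fun _ _ => rfl

end Words

/-! ### Cylinders, gluing at a synchronizing word, and the closing lemma -/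

section Points

variable {A : Type*} [TopologicalSpace A] {X : Subshift A ℤ}

/-- The `n`-th power of the shift on a shift space, for an integer `n`. -/
def shiftBy (X : Subshift A ℤ) (n : ℤ) : X.carrier → X.carrier :=
  fun x => ⟨shift n x.1, X.mapsTo n x.2⟩

@[simp]
theorem shiftBy_apply (n : ℤ) (x : X.carrier) (i : ℤ) : (shiftBy X n x).1 i = x.1 (n + i) :=
  rfl

theorem iterate_shiftMap_apply (n : ℕ) (x : X.carrier) (i : ℤ) :
    ((shiftMap X)^[n] x).1 i = x.1 (n + i) := by
  induction n generalizing i with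
  | zero => simp
  | succ n ih =>
    rw [Function.iterate_succ_apply', shiftMap_apply, ih]
    push_cast
    ring_nf

theorem ext_apply {x y : X.carrier} (h : ∀ i, x.1 i = y.1 i) : x = y :=
  Subtype.ext (funext h)

theorem iterate_shiftMap_eq_shiftBy (n : ℕ) (x : X.carrier) :
    (shiftMap X)^[n] x = shiftBy X n x :=
  ext_apply fun i => iterate_shiftMap_apply n x i

/-- The points `x` and `y` have the same letters on the positions `[-K, K]`. -/
def Agree (K : ℕ) (x y : X.carrier) : Prop :=
  ∀ i : ℤ, -(K : ℤ) ≤ i → i ≤ K → x.1 i = y.1 i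

theorem Agree.symm {K : ℕ} {x y : X.carrier} (h : Agree K x y) : Agree K y x :=
  fun i h₁ h₂ => (h i h₁ h₂).symm

theorem Agree.refl (K : ℕ) (x : X.carrier) : Agree K x x := fun _ _ _ => rfl

theorem Agree.trans {K : ℕ} {x y z : X.carrier} (h : Agree K x y) (h' : Agree K y z) :
    Agree K x z :=
  fun i h₁ h₂ => (h i h₁ h₂).trans (h' i h₁ h₂)

theorem Agree.mono {K L : ℕ} (hKL : K ≤ L) {x y : X.carrier} (h : Agree L x y) : Agree K x y :=
  fun i h₁ h₂ => h i (by omega) (by omega)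

theorem Agree.mem_cylinder {K : ℕ} {v : List A} (hK : v.length ≤ K) {x y : X.carrier}
    (h : Agree K x y) (hy : y ∈ cylinder X v) : x ∈ cylinder X v := by
  intro j
  rw [← hy j]
  have := j.2
  exact h _ (by omega) (by omega)

theorem mem_language_of_occursAt (x : X.carrier) {i : ℤ} {w : List A} (h : OccursAt x.1 i w) :
    w ∈ language X :=
  ⟨x.1, x.2, i, h⟩

/-- A word of the language occurs at any prescribed position of some point. -/
theorem exists_occursAt {w : List A} (hw : w ∈ language X) (i : ℤ) :
    ∃ x : X.carrier, OccursAt x.1 i w := by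
  obtain ⟨x, hx, k, h⟩ := hw
  refine ⟨shiftBy X (k - i) ⟨x, hx⟩, fun j => ?_⟩
  rw [← h j, shiftBy_apply]
  ring_nf

/-- Only closedness is used: the approximating points converge to `g` because each coordinate is
eventually constant. No compactness is needed, so the alphabet may be infinite. -/
theorem mem_carrier_of_forall_agree {g : ℤ → A}
    (h : ∀ M : ℕ, ∃ z : X.carrier, ∀ i : ℤ, -(M : ℤ) ≤ i → i ≤ M → z.1 i = g i) :
    g ∈ X.carrier := by
  choose z hz using h
  refine X.isClosed.mem_of_tendsto (b := Filter.atTop) (f := fun M => (z M).1) ?_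
    (Filter.Eventually.of_forall fun M => (z M).2)
  rw [tendsto_pi_nhds]
  intro i
  refine tendsto_const_nhds.congr' ?_
  filter_upwards [Filter.eventually_ge_atTop i.natAbs] with M hM
  exact (hz M i (by omega) (by omega)).symm

theorem isOpen_setOf_agree [DiscreteTopology A] (K : ℕ) (x : X.carrier) : IsOpen {y : X.carrier | Agree K x y} := by
  have : {y : X.carrier | Agree K x y} =
      ⋂ i ∈ Finset.Icc (-(K : ℤ)) K, {y : X.carrier | y.1 i = x.1 i} := by
    ext y
    simp only [Set.mem_ofPred_eq, Set.mem_iInter, Finset.mem_Icc]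
    exact ⟨fun h i hi => (h i hi.1 hi.2).symm, fun h i h₁ h₂ => (h i ⟨h₁, h₂⟩).symm⟩
  rw [this]
  refine isOpen_biInter_finset fun i _ => ?_
  have hc : Continuous fun y : X.carrier => y.1 i :=
    (continuous_apply i).comp continuous_subtype_val
  exact (isOpen_discrete {x.1 i}).preimage hc

theorem exists_agree_subset {O : Set X.carrier} (hO : IsOpen O) {x : X.carrier} (hx : x ∈ O) :
    ∃ K : ℕ, ∀ y, Agree K x y → y ∈ O := by
  obtain ⟨O', hO', rfl⟩ := isOpen_induced_iff.1 hO
  obtain ⟨I, u, hu, hsub⟩ := isOpen_pi_iff.1 hO' x.1 hx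
  refine ⟨I.sup Int.natAbs, fun y hy => hsub fun i hi => ?_⟩
  have : i.natAbs ≤ I.sup Int.natAbs := Finset.le_sup (f := Int.natAbs) hi
  rw [← hy i (by omega) (by omega)]
  exact (hu i hi).2

/-- Two points which see a synchronizing word at the positions `n` and `0` can be glued there. -/
theorem exists_glue {v : List A} (hv : IsSynchronizing X v) {x y : X.carrier} (n : ℤ)
    (hx : shiftBy X n x ∈ cylinder X v) (hy : y ∈ cylinder X v) :
    ∃ z : X.carrier, (∀ i < n, z.1 i = x.1 i) ∧ ∀ i, n ≤ i → z.1 i = y.1 (i - n) := by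
  classical
  let g : ℤ → A := fun i => if i < 0 then x.1 (n + i) else y.1 i
  have hg : g ∈ X.carrier := by
    refine mem_carrier_of_forall_agree fun M => ?_
    set a : ℕ := v.length / 2 with ha
    set x' := shiftBy X n x with hx'
    let u := wordAt x'.1 (-(a : ℤ) - (M + 1 : ℕ)) (M + 1)
    -- The words `u` and `w`, of length `M + 1` on either side of `v`, make `uvw` cover `[-M, M]`.
    -- On the block of `v` itself both points read `v`, so the place of the cut inside the block
    -- does not matter.
    let w := wordAt y.1 (-(a : ℤ) + v.length) (M + 1)
    have huv : OccursAt x'.1 (-(a : ℤ) - (M + 1 : ℕ)) (u ++ v) := by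
      rw [occursAt_append]
      refine ⟨occursAt_wordAt_self _ _ _, ?_⟩
      rw [length_wordAt, sub_add_cancel]
      exact hx
    have hvw : OccursAt y.1 (-(a : ℤ)) (v ++ w) := by
      rw [occursAt_append]
      exact ⟨hy, occursAt_wordAt_self _ _ _⟩
    have huvw := hv.2 u (mem_language_of_occursAt x' (occursAt_wordAt_self _ _ _))
      w (mem_language_of_occursAt y (occursAt_wordAt_self _ _ _))
      (mem_language_of_occursAt _ huv) (mem_language_of_occursAt _ hvw)
    obtain ⟨z, hz⟩ := exists_occursAt huvw (-(a : ℤ) - (M + 1 : ℕ))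
    rw [occursAt_append, occursAt_append] at hz
    obtain ⟨⟨hzu, hzv⟩, hzw⟩ := hz
    rw [List.length_append, length_wordAt] at hzw
    rw [length_wordAt] at hzv
    have hzu' := (occursAt_wordAt _ _ _ _ _).1 hzu
    have hzw' := (occursAt_wordAt _ _ _ _ _).1 hzw
    refine ⟨z, fun i h₁ h₂ => ?_⟩
    by_cases hi : i < 0
    · simp only [g, if_pos hi]
      by_cases hia : i < -(a : ℤ)
      · have := hzu' (i + a + (M + 1)).toNat (by omega)
        rw [show -(a : ℤ) - (M + 1 : ℕ) + ((i + a + (M + 1)).toNat : ℕ) = i by omega] at this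
        exact this
      · have e₁ := hzv ⟨(i + a).toNat, by omega⟩
        have e₂ := hx ⟨(i + a).toNat, by omega⟩
        rw [← e₂] at e₁
        simp only at e₁
        rw [show -(a : ℤ) - (M + 1 : ℕ) + (M + 1 : ℕ) + ((i + a).toNat : ℕ) = i by omega,
          show -((v.length / 2 : ℕ) : ℤ) + ((i + a).toNat : ℕ) = i by omega] at e₁
        exact e₁
    · simp only [g, if_neg hi]
      by_cases hia : i < -(a : ℤ) + v.length
      · have e₁ := hzv ⟨(i + a).toNat, by omega⟩
        have e₂ := hy ⟨(i + a).toNat, by omega⟩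
        rw [← e₂] at e₁
        simp only at e₁
        rw [show -(a : ℤ) - (M + 1 : ℕ) + (M + 1 : ℕ) + ((i + a).toNat : ℕ) = i by omega,
          show -((v.length / 2 : ℕ) : ℤ) + ((i + a).toNat : ℕ) = i by omega] at e₁
        exact e₁
      · have := hzw' (i + a - v.length).toNat (by omega)
        rw [show -(a : ℤ) - (M + 1 : ℕ) + (M + 1 + v.length : ℕ) +
            ((i + a - v.length).toNat : ℕ) = i by omega,
          show -(a : ℤ) + v.length + ((i + a - v.length).toNat : ℕ) = i by omega] at this
        exact this
  refine ⟨shiftBy X (-n) ⟨g, hg⟩, fun i hi => ?_, fun i hi => ?_⟩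
  · simp only [shiftBy_apply, g]
    rw [if_pos (by omega)]
    ring_nf
  · simp only [shiftBy_apply, g]
    rw [if_neg (by omega)]
    ring_nf

/-- Gluing along an overlap: if `σⁿ x` and `y` agree on `[-K, K]`, the glued point agrees with both
on the overlap. -/
theorem exists_glue_of_agree {v : List A} (hv : IsSynchronizing X v) {x y : X.carrier} (n : ℤ)
    {K : ℕ} (hK : v.length ≤ K) (hxy : Agree K (shiftBy X n x) y) (hy : y ∈ cylinder X v) :
    ∃ z : X.carrier, (∀ i, i ≤ n + K → z.1 i = x.1 i) ∧
      ∀ i, -(K : ℤ) ≤ i → z.1 (n + i) = y.1 i := by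
  obtain ⟨z, h₁, h₂⟩ := exists_glue hv n (hxy.mem_cylinder hK hy) hy
  refine ⟨z, fun i hi => ?_, fun i hi => ?_⟩
  · rcases lt_or_ge i n with h | h
    · exact h₁ i h
    · rw [h₂ i h, ← hxy (i - n) (by omega) (by omega), shiftBy_apply]
      ring_nf
  · rcases lt_or_ge i 0 with h | h
    · rw [h₁ _ (by omega), ← hxy i (by omega) (by omega), shiftBy_apply]
    · rw [h₂ _ (by omega), add_sub_cancel_left]

/-- In a transitive shift space there is an orbit segment from near `a` to near `c`. -/
theorem exists_agree_agree_iterate (hX : IsTransitive X) (K : ℕ) (a c : X.carrier) :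
    ∃ (x : X.carrier) (n : ℕ), Agree K x a ∧ Agree K ((shiftMap X)^[n] x) c := by
  obtain ⟨w, -, hw⟩ := hX _ (mem_language_of_occursAt a (occursAt_wordAt_self a.1 (-(K : ℤ))
    (2 * K + 1))) _ (mem_language_of_occursAt c (occursAt_wordAt_self c.1 (-(K : ℤ)) (2 * K + 1)))
  obtain ⟨x, hx⟩ := exists_occursAt hw (-(K : ℤ))
  rw [occursAt_append, occursAt_append] at hx
  obtain ⟨⟨h₁, -⟩, h₂⟩ := hx
  rw [List.length_append, length_wordAt] at h₂
  rw [occursAt_wordAt] at h₁ h₂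
  refine ⟨x, 2 * K + 1 + w.length, fun i hi hi' => ?_, fun i hi hi' => ?_⟩
  · have := h₁ (i + K).toNat (by omega)
    rwa [show -(K : ℤ) + ((i + K).toNat : ℕ) = i by omega] at this
  · have := h₂ (i + K).toNat (by omega)
    rw [iterate_shiftMap_apply]
    rwa [show -(K : ℤ) + ((i + K).toNat : ℕ) = i by omega,
      show -(K : ℤ) + (2 * K + 1 + w.length : ℕ) + ((i + K).toNat : ℕ) =
        (2 * K + 1 + w.length : ℕ) + i by omega] at this

/-- Closing lemma: a return to a cylinder around a synchronizing word is shadowed by a periodic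
point. -/
theorem exists_periodic_of_agree {v : List A} (hv : IsSynchronizing X v) {x : X.carrier} {n : ℕ}
    (hn : 0 < n) {K : ℕ} (hK : v.length ≤ K) (hx : x ∈ cylinder X v)
    (hxn : Agree K ((shiftMap X)^[n] x) x) :
    ∃ p : X.carrier, Function.IsPeriodicPt (shiftMap X) n p ∧
      ∀ i : ℤ, -(K : ℤ) ≤ i → i ≤ n + K → p.1 i = x.1 i := by
  have hn' : (0 : ℤ) < n := by exact_mod_cast hn
  have hstep : ∀ i : ℤ, -(K : ℤ) ≤ i → i ≤ K → x.1 (n + i) = x.1 i := by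
    intro i h₁ h₂
    rw [← hxn i h₁ h₂, iterate_shiftMap_apply]
  -- The overlap `K` may exceed `n`, so one return can force several repetitions of the block. These
  -- steps extend `n`-periodicity to all of `[-K, n + K]`.
  have hnonneg : ∀ (q : ℕ) (j : ℤ), 0 ≤ j → j < n → j + n * q ≤ n + K →
      x.1 (j + n * q) = x.1 j := by
    intro q
    induction q with
    | zero => intro j _ _ _; simp
    | succ q ih =>
      intro j h₁ h₂ h₃
      push_cast at h₃ ⊢
      have h0 : (0 : ℤ) ≤ n * q := by positivity
      rw [show j + (n : ℤ) * (q + 1) = n + (j + n * q) by ring,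
        hstep _ (by omega) (by linarith), ih j h₁ h₂ (by linarith)]
  have hnonneg' : ∀ i : ℤ, 0 ≤ i → i ≤ n + K → x.1 i = x.1 (i % n) := by
    intro i h₁ h₂
    have e := Int.emod_add_mul_ediv i n
    have h0 : 0 ≤ i / n := Int.ediv_nonneg h₁ hn'.le
    obtain ⟨q, hq⟩ := Int.eq_ofNat_of_zero_le h0
    have := hnonneg q (i % n) (Int.emod_nonneg _ hn'.ne') (Int.emod_lt_of_pos _ hn')
      (by rw [← hq, e]; exact h₂)
    rwa [← hq, e] at this
  have hper : ∀ (m : ℕ) (i : ℤ), -(K : ℤ) ≤ i → i ≤ n + K →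
      -(n * m : ℤ) ≤ i → x.1 i = x.1 (i % n) := by
    intro m
    induction m with
    | zero => intro i h₁ h₂ h₃; exact hnonneg' i (by simpa using h₃) h₂
    | succ m ih =>
      intro i h₁ h₂ h₃
      rcases lt_or_ge i 0 with h | h
      · rw [← hstep i h₁ (by omega), ih (n + i) (by omega) (by omega)
          (by push_cast at h₃; linarith)]
        simp
      · exact hnonneg' i h h₂
  have hmod : ∀ i : ℤ, -(K : ℤ) ≤ i → i ≤ n + K → x.1 i = x.1 (i % n) := by
    intro i h₁ h₂
    -- Going down by `K` periods suffices because `n ≥ 1`.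
    refine hper K i h₁ h₂ ?_
    nlinarith
  -- Each gluing puts one more copy of the block in front, so arbitrarily long stretches of the
  -- periodic sequence occur in points of `X`.
  have hlong : ∀ j : ℕ, ∃ z : X.carrier,
      ∀ i : ℤ, -(K : ℤ) ≤ i → i ≤ n * j + K → z.1 i = x.1 (i % n) := by
    intro j
    induction j with
    | zero => exact ⟨x, fun i h₁ h₂ => hmod i h₁ (by simp at h₂; omega)⟩
    | succ j ih =>
      obtain ⟨z, hz⟩ := ih
      have h0 : (0 : ℤ) ≤ n * j := by positivity
      have hzx : Agree K z x := fun i h₁ h₂ => by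
        rw [hz i h₁ (by linarith), ← hmod i h₁ (by omega)]
      obtain ⟨y, hy₁, hy₂⟩ := exists_glue_of_agree hv (x := x) (y := z) n hK
        (by rw [← iterate_shiftMap_eq_shiftBy]; exact hxn.trans hzx.symm)
        (hzx.mem_cylinder hK hx)
      refine ⟨y, fun i h₁ h₂ => ?_⟩
      rcases lt_or_ge i n with h | h
      · rw [hy₁ i (by omega), hmod i h₁ (by omega)]
      · have := hy₂ (i - n) (by omega)
        rw [add_sub_cancel] at this
        rw [this, hz _ (by omega) (by push_cast at h₂; linarith)]
        simp
  have hg : (fun i : ℤ => x.1 (i % n)) ∈ X.carrier := by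
    refine mem_carrier_of_forall_agree fun M => ?_
    -- After shifting by `n * M`, the stretch made of `2 * M` blocks is centred and covers `[-M,
    -- M]`.
    obtain ⟨z, hz⟩ := hlong (2 * M)
    refine ⟨shiftBy X (n * M) z, fun i h₁ h₂ => ?_⟩
    have h0 : (M : ℤ) ≤ n * M := le_mul_of_one_le_left (by positivity) (by omega)
    rw [shiftBy_apply, hz _ (by omega) (by push_cast; linarith)]
    simp
  refine ⟨⟨_, hg⟩, ?_, fun i h₁ h₂ => (hmod i h₁ h₂).symm⟩
  refine ext_apply fun i => ?_
  rw [iterate_shiftMap_apply]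
  simp

end Points

/-! ### Lengths of paths and the group of return differences -/

section Paths

variable {A : Type*} [TopologicalSpace A] {X : Subshift A ℤ} {r : X.carrier → ℝ} {v : List A}

theorem HasWaltersProperty.exists_abs_birkhoffSum_sub_lt (hr : HasWaltersProperty X r) {ε : ℝ}
    (hε : 0 < ε) : ∃ k : ℕ, ∀ (n : ℕ) (x y : X.carrier),
      (∀ i : ℤ, -(k : ℤ) ≤ i → i ≤ (n : ℤ) + (k : ℤ) → x.1 i = y.1 i) →
        |birkhoffSum (shiftMap X) r n x - birkhoffSum (shiftMap X) r n y| < ε := by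
  obtain ⟨k, hk⟩ := hr ε hε
  refine ⟨k, fun n x y h => ?_⟩
  have := hk n x y h
  rwa [Finset.sum_sub_distrib] at this

theorem HasWaltersProperty.continuous [DiscreteTopology A] (hr : HasWaltersProperty X r) :
    Continuous r := by
  rw [continuous_iff_continuousAt]
  intro x
  rw [ContinuousAt, Metric.tendsto_nhds]
  intro ε hε
  obtain ⟨k, hk⟩ := hr.exists_abs_birkhoffSum_sub_lt hε
  filter_upwards [(isOpen_setOf_agree (k + 1) x).mem_nhds (Agree.refl _ x)] with y hy
  have := hk 1 y x fun i h₁ h₂ => (hy i (by push_cast; omega) (by push_cast at h₂ ⊢; omega)).symm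
  rwa [birkhoffSum_one, birkhoffSum_one] at this

theorem birkhoffSum_mul_of_isPeriodicPt {p : X.carrier} {N : ℕ}
    (hp : Function.IsPeriodicPt (shiftMap X) N p) (n : ℕ) :
    birkhoffSum (shiftMap X) r (N * n) p = n * birkhoffSum (shiftMap X) r N p := by
  induction n with
  | zero => simp
  | succ n ih =>
    rw [Nat.mul_succ, birkhoffSum_add, ih, hp.mul_const n]
    push_cast
    ring

theorem apply_mul_add_of_isPeriodicPt {p : X.carrier} {N : ℕ}
    (hp : Function.IsPeriodicPt (shiftMap X) N p) (c : ℕ) (i : ℤ) :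
    p.1 ((N * c : ℕ) + i) = p.1 i := by
  rw [← iterate_shiftMap_apply, hp.mul_const c]

/-- The closing lemma produces some period, not necessarily the least one; the sum over it is an
integer multiple of the sum over the least period. -/
theorem isPeriodicPt_birkhoffSum_mem_zmultiples {p : X.carrier} {N : ℕ} {δ : ℝ}
    (hp : Function.IsPeriodicPt (shiftMap X) N p)
    (h : birkhoffSum (shiftMap X) r (Function.minimalPeriod (shiftMap X) p) p ∈
      AddSubgroup.zmultiples δ) :
    birkhoffSum (shiftMap X) r N p ∈ AddSubgroup.zmultiples δ := by
  obtain ⟨c, rfl⟩ := hp.minimalPeriod_dvd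
  rw [birkhoffSum_mul_of_isPeriodicPt (Function.isPeriodicPt_minimalPeriod _ _), ← nsmul_eq_mul]
  exact AddSubgroup.nsmul_mem _ h c

/-- `t` is the Birkhoff sum of `r` along an orbit segment which starts in the cylinder of `a` and
ends in the cylinder of `c`, both taken over the positions `[-K, K]`. -/
def IsPath (r : X.carrier → ℝ) (K : ℕ) (a c : X.carrier) (t : ℝ) : Prop :=
  ∃ (x : X.carrier) (n : ℕ), Agree K x a ∧ Agree K ((shiftMap X)^[n] x) c ∧
    birkhoffSum (shiftMap X) r n x = t

theorem IsPath.mono {K L : ℕ} (hKL : K ≤ L) {a c : X.carrier} {t : ℝ} (h : IsPath r L a c t) :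
    IsPath r K a c t := by
  obtain ⟨x, n, h₁, h₂, h₃⟩ := h
  exact ⟨x, n, h₁.mono hKL, h₂.mono hKL, h₃⟩

theorem IsPath.zero (K : ℕ) (a : X.carrier) : IsPath r K a a 0 :=
  ⟨a, 0, Agree.refl _ _, Agree.refl _ _, birkhoffSum_zero _ _ _⟩

theorem exists_isPath (hX : IsTransitive X) (r : X.carrier → ℝ) (K : ℕ) (a c : X.carrier) :
    ∃ t, IsPath r K a c t := by
  obtain ⟨x, n, h₁, h₂⟩ := exists_agree_agree_iterate hX K a c
  exact ⟨_, x, n, h₁, h₂, rfl⟩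

/-- Paths can be concatenated at a point of the synchronizing cylinder, with a small error. -/
theorem IsPath.exists_concat (hv : IsSynchronizing X v) (hr : HasWaltersProperty X r) {ε : ℝ}
    (hε : 0 < ε) : ∃ K₀ : ℕ, ∀ K, K₀ ≤ K → ∀ (a b c : X.carrier) (s t : ℝ), b ∈ cylinder X v →
      IsPath r K a b s → IsPath r K b c t → ∃ u, IsPath r K a c u ∧ |u - (s + t)| < ε := by
  obtain ⟨k, hk⟩ := hr.exists_abs_birkhoffSum_sub_lt (half_pos hε)
  -- The summand `k` gives agreement `k` places across the junction, the margin that the Walters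
  -- property requires for both halves; `v.length` keeps the junction inside the cylinder of `v`.
  refine ⟨k + v.length, fun K hK a b c s t hb => ?_⟩
  rintro ⟨x, n, hxa, hxb, rfl⟩ ⟨y, m, hyb, hyc, rfl⟩
  obtain ⟨z, hzx, hzy⟩ := exists_glue_of_agree hv (x := x) (y := y) (n : ℤ) (K := K) (by omega)
    (by rw [← iterate_shiftMap_eq_shiftBy]; exact hxb.trans hyb.symm)
    (hyb.mem_cylinder (by omega) hb)
  refine ⟨_, ⟨z, n + m, fun i h₁ h₂ => ?_, fun i h₁ h₂ => ?_, rfl⟩, ?_⟩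
  · rw [hzx i (by omega), hxa i h₁ h₂]
  · rw [← hyc i h₁ h₂, iterate_shiftMap_apply, iterate_shiftMap_apply, ← hzy _ (by omega)]
    push_cast
    ring_nf
  · rw [birkhoffSum_add]
    have e₁ := hk n z x fun i h₁ h₂ => hzx i (by omega)
    have e₂ := hk m ((shiftMap X)^[n] z) y fun i h₁ h₂ => by
      rw [iterate_shiftMap_apply, hzy i (by omega)]
    rw [abs_lt] at *
    constructor <;> linarith [e₁.1, e₁.2, e₂.1, e₂.2]

/-- The error grows with the number of pieces, so this serves for a number of pieces fixed in
advance. -/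
theorem IsPath.exists_list_sum {K : ℕ} {p : X.carrier} {ε : ℝ}
    (hcat : ∀ s t, IsPath r K p p s → IsPath r K p p t →
      ∃ u, IsPath r K p p u ∧ |u - (s + t)| < ε) (l : List ℝ) (hl : ∀ s ∈ l, IsPath r K p p s) :
    ∃ u, IsPath r K p p u ∧ |u - l.sum| ≤ l.length * ε := by
  induction l with
  | nil => exact ⟨0, IsPath.zero K p, by simp⟩
  | cons s l ih =>
    obtain ⟨u, hu, hu'⟩ := ih fun t ht => hl t (List.mem_cons_of_mem _ ht)
    obtain ⟨w, hw, hw'⟩ := hcat s u (hl s List.mem_cons_self) hu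
    refine ⟨w, hw, ?_⟩
    rw [List.sum_cons, List.length_cons]
    push_cast
    rw [abs_le] at *
    rw [abs_lt] at hw'
    constructor <;> linarith [hu'.1, hu'.2, hw'.1, hw'.2]

/-- The group of limits of differences between the lengths of closed paths at `p`. -/
def returnDifferences (hv : IsSynchronizing X v) (hr : HasWaltersProperty X r) {p : X.carrier}
    (hp : p ∈ cylinder X v) : AddSubgroup ℝ where
  carrier := {d | ∀ (ε : ℝ) (K : ℕ), 0 < ε →
    ∃ s s', IsPath r K p p s ∧ IsPath r K p p s' ∧ |s - s' - d| < ε}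
  zero_mem' := fun ε K hε => ⟨0, 0, IsPath.zero K p, IsPath.zero K p, by simpa using hε⟩
  neg_mem' := by
    intro d hd ε K hε
    obtain ⟨s, s', hs, hs', h⟩ := hd ε K hε
    refine ⟨s', s, hs', hs, ?_⟩
    rw [← abs_neg]
    convert h using 2
    ring
  add_mem' := by
    intro d e hd he ε K hε
    obtain ⟨K₀, hK₀⟩ := IsPath.exists_concat hv hr (show 0 < ε / 4 by positivity)
    obtain ⟨s, s', hs, hs', h⟩ := hd (ε / 4) (max K K₀) (by positivity)
    obtain ⟨t, t', ht, ht', h'⟩ := he (ε / 4) (max K K₀) (by positivity)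
    obtain ⟨u, hu, h₁⟩ := hK₀ _ (le_max_right K K₀) _ _ _ _ _ hp hs ht
    obtain ⟨u', hu', h₂⟩ := hK₀ _ (le_max_right K K₀) _ _ _ _ _ hp hs' ht'
    refine ⟨u, u', hu.mono (le_max_left _ _), hu'.mono (le_max_left _ _), ?_⟩
    rw [abs_lt] at *
    constructor <;> linarith [h.1, h.2, h'.1, h'.2, h₁.1, h₁.2, h₂.1, h₂.2]

/-- A point which follows `p` in the past, `q` on `[0, T)`, and `p` again from time `T` on. -/
theorem exists_excursion (hv : IsSynchronizing X v) {p q : X.carrier} (hp : p ∈ cylinder X v)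
    (hq : q ∈ cylinder X v) {T : ℕ} (hT : v.length ≤ T) (hqT : ∀ i : ℤ, q.1 (T + i) = q.1 i) :
    ∃ y : X.carrier, (∀ i < 0, y.1 i = p.1 i) ∧ (∀ i : ℤ, 0 ≤ i → i < T → y.1 i = q.1 i) ∧
      ∀ i : ℤ, T ≤ i → y.1 i = p.1 (i - T) := by
  have hp' : shiftBy X 0 p ∈ cylinder X v := by
    rwa [show shiftBy X 0 p = p from ext_apply fun i => by simp]
  obtain ⟨w, hwp, hwq⟩ := exists_glue hv 0 hp' hq
  -- The window `[-T, T]` around time `T` starts at time `0`, from where `w` follows `q`; thus `w`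
  -- sees `v` again at time `T` and can be switched back to `p`.
  have hw : Agree T (shiftBy X T w) q := fun i h₁ h₂ => by
    rw [shiftBy_apply, hwq _ (by omega), sub_zero, hqT]
  obtain ⟨y, hyw, hyp⟩ := exists_glue hv (T : ℤ) (hw.mem_cylinder hT hq) hp
  refine ⟨y, fun i hi => ?_, fun i h₁ h₂ => ?_, hyp⟩
  · rw [hyw i (by omega), hwp i hi]
  · rw [hyw i h₂, hwq i h₁, sub_zero]

/-- Two excursions from `p` are compared, `y` following `q` for time `2Q` and `z` for time `2Q + m`.
Cutting in the middle of the stretch along `q`, the initial and final pieces of `z` match those of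
`y`, and the extra piece of `z` is one period of `q`. -/
theorem birkhoffSum_mem_returnDifferences (hv : IsSynchronizing X v)
    (hr : HasWaltersProperty X r) {p q : X.carrier} (hp : p ∈ cylinder X v)
    (hq : q ∈ cylinder X v) {N m : ℕ} (hN : 0 < N) (hm : 0 < m)
    (hpN : Function.IsPeriodicPt (shiftMap X) N p)
    (hqm : Function.IsPeriodicPt (shiftMap X) m q) :
    birkhoffSum (shiftMap X) r m q ∈ returnDifferences hv hr hp := by
  intro ε K hε
  obtain ⟨k, hk⟩ := hr.exists_abs_birkhoffSum_sub_lt (show 0 < ε / 4 by positivity)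
  -- `Q` is a multiple of the period of `q` that leaves a margin `k` around the cut; `P` is a
  -- multiple of the period of `p` that keeps the windows of radius `K` at both ends inside the
  -- stretches along `p`.
  obtain ⟨Q, hQ, hqQ⟩ : ∃ Q : ℕ, k + v.length < Q ∧ ∀ i : ℤ, q.1 (Q + i) = q.1 i :=
    ⟨m * (k + v.length + 1), Nat.le_mul_of_pos_left _ hm,
      apply_mul_add_of_isPeriodicPt hqm _⟩
  obtain ⟨P, hP, hpP⟩ : ∃ P : ℕ, K < P ∧ ∀ i : ℤ, p.1 (P + i) = p.1 i :=
    ⟨N * (K + 1), Nat.le_mul_of_pos_left _ hN, apply_mul_add_of_isPeriodicPt hpN _⟩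
  have hqm' : ∀ i : ℤ, q.1 (m + i) = q.1 i := fun i => by
    simpa using apply_mul_add_of_isPeriodicPt hqm 1 i
  have hpath : ∀ T : ℕ, ∀ y : X.carrier, (∀ i < 0, y.1 i = p.1 i) →
      (∀ i : ℤ, T ≤ i → y.1 i = p.1 (i - T)) →
      IsPath r K p p (birkhoffSum (shiftMap X) r (P + T + P) (shiftBy X (-P) y)) := by
    intro T y h₁ h₂
    refine ⟨_, _, fun i hi hi' => ?_, fun i hi hi' => ?_, rfl⟩
    · rw [shiftBy_apply, h₁ _ (by omega), ← hpP]
      ring_nf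
    · rw [iterate_shiftMap_apply, shiftBy_apply, h₂ _ (by push_cast; omega), ← hpP i]
      push_cast
      ring_nf
  obtain ⟨y, hy₁, hy₂, hy₃⟩ := exists_excursion hv hp hq (T := Q + Q) (by omega)
    (fun i => by push_cast; rw [add_assoc, hqQ, hqQ])
  obtain ⟨z, hz₁, hz₂, hz₃⟩ := exists_excursion hv hp hq (T := Q + m + Q) (by omega)
    (fun i => by push_cast; rw [add_assoc, add_assoc, hqQ, hqm', hqQ])
  refine ⟨_, _, hpath _ z hz₁ hz₃, hpath _ y hy₁ hy₃, ?_⟩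
  rw [show P + (Q + m + Q) + P = P + Q + m + (Q + P) by ring,
    show P + (Q + Q) + P = P + Q + (Q + P) by ring, birkhoffSum_add, birkhoffSum_add,
    birkhoffSum_add (m := P + Q) (n := Q + P)]
  set x := shiftBy X (-P) y with hx
  set x' := shiftBy X (-P) z with hx'
  have e₁ := hk (P + Q) x' x fun i h₁ h₂ => by
    simp only [hx, hx', shiftBy_apply]
    push_cast at h₂
    rcases lt_or_ge (-(P : ℤ) + i) 0 with h | h
    · rw [hy₁ _ h, hz₁ _ h]
    · rw [hy₂ _ h (by push_cast; omega), hz₂ _ h (by push_cast; omega)]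
  have e₂ := hk m ((shiftMap X)^[P + Q] x') q fun i h₁ h₂ => by
    rw [iterate_shiftMap_apply, hx', shiftBy_apply,
      hz₂ _ (by push_cast; omega) (by push_cast; omega), ← hqQ i]
    push_cast
    ring_nf
  have e₃ := hk (Q + P) ((shiftMap X)^[P + Q + m] x') ((shiftMap X)^[P + Q] x) fun i h₁ h₂ => by
    rw [iterate_shiftMap_apply, iterate_shiftMap_apply, hx, hx', shiftBy_apply, shiftBy_apply]
    push_cast
    rcases lt_or_ge i Q with h | h
    · rw [hz₂ _ (by omega) (by push_cast; omega), hy₂ _ (by omega) (by push_cast; omega),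
        ← hqm' (-(P : ℤ) + (P + Q + i))]
      ring_nf
    · rw [hz₃ _ (by push_cast; omega), hy₃ _ (by push_cast; omega)]
      push_cast
      ring_nf
  rw [abs_lt] at *
  constructor <;> linarith [e₁.1, e₁.2, e₂.1, e₂.2, e₃.1, e₃.2]

/-- If the return differences are dense, the lengths of closed paths are eventually dense. -/
theorem exists_isPath_near_of_dense (hv : IsSynchronizing X v) (hr : HasWaltersProperty X r)
    (hpos : ∀ x, 0 < r x) {p : X.carrier} (hp : p ∈ cylinder X v) {N : ℕ} (hN : 0 < N)
    (hpN : Function.IsPeriodicPt (shiftMap X) N p)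
    (hD : Dense (returnDifferences hv hr hp : Set ℝ)) {ε : ℝ} (hε : 0 < ε) (K : ℕ) :
    ∃ T : ℝ, ∀ t, T ≤ t → ∃ s, IsPath r K p p s ∧ |s - t| < ε := by
  -- Replacing `s'` by `s` lengthens a closed path by about `d`. Since `J * d ≥ a`, at most `J`
  -- replacements sweep a full period length `a` in steps shorter than `ε / 2`.
  obtain ⟨d, hd, hd₀, hdε⟩ := hD.exists_between (half_pos hε)
  set a := birkhoffSum (shiftMap X) r N p with ha
  have ha₀ : 0 < a := Finset.sum_pos (fun _ _ => hpos _) (by simpa using hN.ne')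
  obtain ⟨J, hJ⟩ := exists_nat_ge (a / d)
  rw [div_le_iff₀ hd₀] at hJ
  set e := ε / (4 * (J + 1)) with he
  have he₀ : 0 < e := by positivity
  have heJ : (J + 1) * e = ε / 4 := by rw [he]; field_simp
  obtain ⟨K₀, hK₀⟩ := IsPath.exists_concat hv hr he₀
  have hcat := fun s t => hK₀ _ (le_max_right K K₀) p p p s t hp
  obtain ⟨s, s', hs, hs', hss⟩ := hd e (max K K₀) he₀
  refine ⟨J * s', fun t ht => ?_⟩
  set n := ⌊(t - J * s') / a⌋₊ with hn
  have hn₁ : n * a ≤ t - J * s' := by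
    rw [← le_div_iff₀ ha₀]
    exact Nat.floor_le (div_nonneg (by linarith) ha₀.le)
  have hn₂ : t - J * s' < (n + 1) * a := by
    rw [← div_lt_iff₀ ha₀]
    exact Nat.lt_floor_add_one _
  set ρ := t - J * s' - n * a with hρ
  set j := ⌊ρ / d⌋₊ with hj
  have hj₁ : j * d ≤ ρ := by
    rw [← le_div_iff₀ hd₀]
    exact Nat.floor_le (div_nonneg (by linarith) hd₀.le)
  have hj₂ : ρ < (j + 1) * d := by
    rw [← div_lt_iff₀ hd₀]
    exact Nat.lt_floor_add_one _
  have hjJ : j ≤ J := by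
    have : (j : ℝ) * d ≤ J * d := by linarith
    exact_mod_cast le_of_mul_le_mul_right this hd₀
  -- All `n` turns along `p` form a single exact path, so the list below has `J + 1` pieces whatever
  -- `t` is, and the concatenation error stays at most `(J + 1) * e = ε / 4`.
  have hrun : IsPath r (max K K₀) p p (n * a) :=
    ⟨p, N * n, Agree.refl _ _, by rw [hpN.mul_const n]; exact Agree.refl _ _,
      birkhoffSum_mul_of_isPeriodicPt hpN n⟩
  obtain ⟨u, hu, hu'⟩ := IsPath.exists_list_sum hcat
    (n * a :: (List.replicate j s ++ List.replicate (J - j) s')) (by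
      intro x hx
      rw [List.mem_cons, List.mem_append] at hx
      rcases hx with rfl | hx | hx
      · exact hrun
      · rw [List.eq_of_mem_replicate hx]; exact hs
      · rw [List.eq_of_mem_replicate hx]; exact hs')
  refine ⟨u, hu.mono (le_max_left _ _), ?_⟩
  simp only [List.sum_cons, List.sum_append, List.sum_replicate, List.length_cons,
    List.length_append, List.length_replicate, nsmul_eq_mul, Nat.add_sub_of_le hjJ,
    Nat.cast_sub hjJ] at hu'
  push_cast at hu'
  rw [heJ] at hu'
  have hjs : |(j : ℝ) * (s - s' - d)| ≤ ε / 4 := by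
    rw [abs_mul, Nat.abs_cast, ← heJ]
    have : (j : ℝ) ≤ J + 1 := by exact_mod_cast hjJ.trans (Nat.le_succ J)
    exact mul_le_mul this hss.le (abs_nonneg _) (by positivity)
  rw [abs_le] at hu' hjs
  rw [abs_lt]
  constructor <;> linarith [hu'.1, hu'.2, hjs.1, hjs.2]

end Paths

/-! ### Openness of the projection to the suspension -/

section SuspensionTopology

variable {Y : Type*} [TopologicalSpace Y]

theorem continuous_mk (f : Y → Y) (r : Y → ℝ) : Continuous (SuspensionSpace.mk f r) :=
  continuous_quot_mk

/-- The projection to the suspension of a homeomorphism with continuous roof function is open. -/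
theorem isOpenMap_mk {f g : Y → Y} (hgf : Function.LeftInverse g f)
    (hfg : Function.RightInverse g f) (hg : Continuous g) (hf : Continuous f) {r : Y → ℝ}
    (hr : Continuous r) : IsOpenMap (SuspensionSpace.mk f r) := by
  intro W hW
  let F : Y × ℝ → Y × ℝ := fun p => (f p.1, p.2 - r p.1)
  let G : Y × ℝ → Y × ℝ := fun p => (g p.1, p.2 + r (g p.1))
  have hF : Continuous F := by fun_prop
  have hG : Continuous G := by fun_prop
  have hFo : IsOpenMap F := IsOpenMap.of_inverse hG
    (fun p => Prod.ext (hfg p.1) (by simp [F, G]))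
    (fun p => Prod.ext (hgf p.1) (by simp [F, G, hgf p.1]))
  have hFno : ∀ n : ℕ, IsOpenMap F^[n] := fun n => by
    induction n with
    | zero => exact IsOpenMap.id
    | succ n ih => exact ih.comp hFo
  have hFn : ∀ (n : ℕ) (p : Y × ℝ), F^[n] p = (f^[n] p.1, p.2 - birkhoffSum f r n p.1) := by
    intro n p
    induction n with
    | zero => simp
    | succ n ih =>
      rw [Function.iterate_succ_apply', ih, Function.iterate_succ_apply', birkhoffSum_succ]
      simp only [F]
      rw [sub_sub]
  -- The identification is the orbit relation of the homeomorphism `F`, so the saturation of `W` is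
  -- a union of its translates under powers of `F`.
  have hpre : SuspensionSpace.mk f r ⁻¹' (SuspensionSpace.mk f r '' W) =
      ⋃ (m : ℕ) (n : ℕ), F^[m] ⁻¹' (F^[n] '' W) := by
    ext q
    simp only [Set.mem_preimage, Set.mem_image, Set.mem_iUnion]
    constructor
    · rintro ⟨p, hp, h⟩
      obtain ⟨n, m, h₁, h₂⟩ := (mk_eq_mk_iff f r p q).1 h
      exact ⟨m, n, p, hp, by rw [hFn, hFn, h₁, h₂]⟩
    · rintro ⟨m, n, p, hp, h⟩
      rw [hFn, hFn] at h
      exact ⟨p, hp, (mk_eq_mk_iff f r p q).2 ⟨n, m, congrArg Prod.fst h, congrArg Prod.snd h⟩⟩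
  have hopen : IsOpen (SuspensionSpace.mk f r ⁻¹' (SuspensionSpace.mk f r '' W)) := by
    rw [hpre]
    exact isOpen_iUnion fun m => isOpen_iUnion fun n =>
      (hFno n W hW).preimage (hF.iterate m)
  exact isQuotientMap_quot_mk.isOpen_preimage.1 hopen

end SuspensionTopology

/-! ### The two directions of the mixing criterion -/

section Mixing

variable {A : Type*} [TopologicalSpace A] {X : Subshift A ℤ} {r : X.carrier → ℝ} {v : List A}

theorem continuous_shiftBy (n : ℤ) : Continuous (shiftBy X n) := by
  refine Continuous.subtype_mk (continuous_pi fun i => ?_) _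
  exact (continuous_apply (n + i)).comp continuous_subtype_val

theorem shiftMap_eq_shiftBy : shiftMap X = shiftBy X 1 := rfl

theorem shiftBy_shiftBy (m n : ℤ) (x : X.carrier) : shiftBy X m (shiftBy X n x) =
    shiftBy X (n + m) x :=
  ext_apply fun i => by simp [add_assoc]

theorem shiftBy_zero (x : X.carrier) : shiftBy X 0 x = x :=
  ext_apply fun i => by simp

theorem isOpenMap_mk_shiftMap (hr : Continuous r) :
    IsOpenMap (SuspensionSpace.mk (shiftMap X) r) := by
  rw [shiftMap_eq_shiftBy]
  exact isOpenMap_mk (g := shiftBy X (-1))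
    (fun x => by rw [shiftBy_shiftBy, add_neg_cancel, shiftBy_zero])
    (fun x => by rw [shiftBy_shiftBy, neg_add_cancel, shiftBy_zero])
    (continuous_shiftBy _) (continuous_shiftBy _) hr

theorem exists_agree_mk_mem {O : Set (SuspensionSpace (shiftMap X) r)} (hO : IsOpen O)
    {x : X.carrier} {s : ℝ} (hx : SuspensionSpace.mk (shiftMap X) r (x, s) ∈ O) :
    ∃ (K : ℕ) (ε : ℝ), 0 < ε ∧ ∀ (y : X.carrier) (s' : ℝ), Agree K x y → |s' - s| < ε →
      SuspensionSpace.mk (shiftMap X) r (y, s') ∈ O := by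
  obtain ⟨U, V, hU, hV, hxU, hsV, hsub⟩ :=
    isOpen_prod_iff.1 (hO.preimage (continuous_mk (shiftMap X) r)) x s hx
  obtain ⟨K, hK⟩ := exists_agree_subset hU hxU
  obtain ⟨ε, hε, hεV⟩ := Metric.isOpen_iff.1 hV s hsV
  exact ⟨K, ε, hε, fun y s' hy hs' => hsub (Set.mk_mem_prod (hK y hy) (hεV hs'))⟩

theorem isTopologicallyMixing_of_dense (hX : IsTransitive X) (hv : IsSynchronizing X v)
    (hr : HasWaltersProperty X r) (hpos : ∀ x, 0 < r x) {p : X.carrier}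
    (hp : p ∈ cylinder X v) {N : ℕ} (hN : 0 < N)
    (hpN : Function.IsPeriodicPt (shiftMap X) N p)
    (hD : Dense (returnDifferences hv hr hp : Set ℝ)) :
    IsTopologicallyMixing (suspensionFlow (shiftMap X) r) := by
  rintro U V hU hV ⟨P₁, hP₁⟩ ⟨P₂, hP₂⟩
  obtain ⟨⟨x₁, s₁⟩, rfl⟩ := Quot.exists_rep P₁
  obtain ⟨⟨x₂, s₂⟩, rfl⟩ := Quot.exists_rep P₂
  obtain ⟨K₁, ε₁, hε₁, h₁⟩ := exists_agree_mk_mem hU hP₁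
  obtain ⟨K₂, ε, hε, h₂⟩ := exists_agree_mk_mem hV hP₂
  have hε' : 0 < ε / 4 := by positivity
  obtain ⟨K₀, hK₀⟩ := IsPath.exists_concat hv hr hε'
  set K := max K₀ (max K₁ K₂) with hK
  have hKK₀ : K₀ ≤ K := le_max_left _ _
  have hKK₁ : K₁ ≤ K := (le_max_left _ _).trans (le_max_right _ _)
  have hKK₂ : K₂ ≤ K := (le_max_right _ _).trans (le_max_right _ _)
  obtain ⟨a, ha⟩ := exists_isPath hX r K x₁ p
  obtain ⟨c, hc⟩ := exists_isPath hX r K p x₂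
  obtain ⟨T, hT⟩ := exists_isPath_near_of_dense hv hr hpos hp hN hpN hD hε' K
  refine ⟨T + a + c - s₁ + s₂, fun t ht => ?_⟩
  -- The closed path at `p` fills the time left over by the connections from `x₁` to `p` and from
  -- `p` to `x₂`. The total length `u` is then within `3ε/4` of `t + s₁ - s₂`.
  obtain ⟨s, hs, hst⟩ := hT (t + s₁ - s₂ - a - c) (by linarith)
  obtain ⟨w, hw, hw'⟩ := hK₀ K hKK₀ _ _ _ _ _ hp ha hs
  obtain ⟨u, ⟨x, n, hx, hxn, hxu⟩, hu'⟩ := hK₀ K hKK₀ _ _ _ _ _ hp hw hc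
  refine ⟨_, Set.mem_image_of_mem _ (h₁ x s₁ (hx.symm.mono hKK₁) (by simpa using hε₁)), ?_⟩
  rw [suspensionFlow_mk (shiftMap X) r t s₁ (t + s₁ - u) n x (by rw [hxu]; ring)]
  refine h₂ _ _ (hxn.symm.mono hKK₂) ?_
  rw [abs_lt] at *
  constructor <;> linarith [hst.1, hst.2, hw'.1, hw'.2, hu'.1, hu'.2]

/-- A return of the suspension flow to a flow box comes from a return of the shift. -/
theorem exists_iterate_eq_of_mk_eq (hpos : ∀ x, 0 < r x) {x y : X.carrier} {s s' : ℝ}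
    (hs : s' < s)
    (h : SuspensionSpace.mk (shiftMap X) r (x, s) = SuspensionSpace.mk (shiftMap X) r (y, s')) :
    ∃ n : ℕ, 0 < n ∧ (shiftMap X)^[n] x = y ∧ birkhoffSum (shiftMap X) r n x = s - s' := by
  obtain ⟨m, n, h₁, h₂⟩ := (mk_eq_mk_iff _ _ _ _).1 h
  simp only at h₁ h₂
  have hinj := (shiftMap_bijective X).1
  rcases le_or_gt m n with hmn | hmn
  · obtain ⟨k, rfl⟩ := Nat.exists_eq_add_of_le' hmn
    rw [Nat.add_comm, Function.iterate_add_apply] at h₁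
    have e := hinj.iterate m h₁
    rw [birkhoffSum_add, ← e] at h₂
    have : 0 ≤ birkhoffSum (shiftMap X) r k y := Finset.sum_nonneg fun _ _ => (hpos _).le
    linarith
  · obtain ⟨k, rfl⟩ := Nat.exists_eq_add_of_lt hmn
    rw [show n + k + 1 = n + (k + 1) by ring, Function.iterate_add_apply] at h₁
    have e := hinj.iterate n h₁
    rw [show n + k + 1 = k + 1 + n by ring, birkhoffSum_add, e] at h₂
    exact ⟨k + 1, by omega, e, by linarith⟩

theorem not_isTopologicallyMixing_of_forall_mem_zmultiples [DiscreteTopology A]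
    (hv : IsSynchronizing X v) (hr : HasWaltersProperty X r) (hpos : ∀ x, 0 < r x) {δ : ℝ}
    (hδ : 0 < δ)
    (h : ∀ p ∈ cylinder X v, p ∈ Function.periodicPts (shiftMap X) →
      birkhoffSum (shiftMap X) r (Function.minimalPeriod (shiftMap X) p) p ∈
        AddSubgroup.zmultiples δ) :
    ¬ IsTopologicallyMixing (suspensionFlow (shiftMap X) r) := by
  intro hmix
  obtain ⟨x₀, hx₀⟩ := exists_occursAt hv.1 (-((v.length / 2 : ℕ) : ℤ))
  have hε : 0 < δ / 8 := by positivity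
  obtain ⟨k, hk⟩ := hr.exists_abs_birkhoffSum_sub_lt hε
  set K := k + v.length with hK
  set W : Set (X.carrier × ℝ) := {y | Agree K x₀ y} ×ˢ Metric.ball 0 (δ / 8) with hW
  have hWo : IsOpen W := (isOpen_setOf_agree K x₀).prod Metric.isOpen_ball
  have hWne : W.Nonempty := ⟨(x₀, 0), Agree.refl K x₀, Metric.mem_ball_self hε⟩
  have hUo := isOpenMap_mk_shiftMap hr.continuous W hWo
  obtain ⟨T, hT⟩ := hmix _ _ hUo hUo (hWne.image _) (hWne.image _)
  obtain ⟨j, hj⟩ := exists_nat_ge (T / δ)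
  rw [div_le_iff₀ hδ] at hj
  have hj₀ : 0 ≤ (j : ℝ) * δ := by positivity
  obtain ⟨_, ⟨_, ⟨⟨x, s⟩, ⟨hx, hs⟩, rfl⟩, rfl⟩, ⟨⟨y, s'⟩, ⟨hy, hs'⟩, hxy⟩⟩ :=
    -- The heights in the box and the shadowing contribute an error below `3 * (δ / 8) < δ / 2`, so
    -- the period sum `z * δ` would lie strictly between `j * δ` and `(j + 1) * δ`.
    hT (j * δ + δ / 2) (by linarith)
  simp only [Set.mem_ofPred_eq, mem_ball_zero_iff, Real.norm_eq_abs, abs_lt] at hx hs hy hs'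
  obtain ⟨n, hn, hny, hns⟩ := exists_iterate_eq_of_mk_eq hpos
    (x := x) (s := s + (j * δ + δ / 2)) (by linarith [hs.1, hs'.2]) hxy.symm
  obtain ⟨p, hpn, hpx⟩ := exists_periodic_of_agree hv hn (K := K) (by omega)
    (hx.symm.mem_cylinder (by omega) hx₀) (by rw [hny]; exact hy.symm.trans hx)
  have hpv : p ∈ cylinder X v :=
    Agree.mem_cylinder (K := K) (by omega) (fun i h₁ h₂ => hpx i h₁ (by omega))
      (hx.symm.mem_cylinder (by omega) hx₀)
  obtain ⟨z, hz⟩ := AddSubgroup.mem_zmultiples_iff.1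
    (isPeriodicPt_birkhoffSum_mem_zmultiples hpn (h p hpv ⟨n, hn, hpn⟩))
  have hclose := hk n p x fun i h₁ h₂ => hpx i (by omega) (by omega)
  rw [← hz, hns, zsmul_eq_mul, abs_lt] at hclose
  have h₁ : ((z - j : ℤ) : ℝ) * δ < 1 * δ := by push_cast; linarith [hclose.2, hs.2, hs'.1]
  have h₂ : ((0 : ℤ) : ℝ) * δ < (z - j : ℤ) * δ := by
    push_cast; linarith [hclose.1, hs.1, hs'.2]
  have h₃ : (z - j : ℤ) < 1 := by exact_mod_cast lt_of_mul_lt_mul_right h₁ hδ.le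
  have h₄ : 0 < (z - j : ℤ) := by exact_mod_cast lt_of_mul_lt_mul_right h₂ hδ.le
  omega

theorem exists_forall_mem_zmultiples_of_not_isTopologicallyMixing (hX : IsTransitive X)
    (hv : IsSynchronizing X v) (hr : HasWaltersProperty X r) (hpos : ∀ x, 0 < r x)
    (hmix : ¬ IsTopologicallyMixing (suspensionFlow (shiftMap X) r)) :
    ∃ δ : ℝ, 0 < δ ∧ ∀ p ∈ cylinder X v, p ∈ Function.periodicPts (shiftMap X) →
      birkhoffSum (shiftMap X) r (Function.minimalPeriod (shiftMap X) p) p ∈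
        AddSubgroup.zmultiples δ := by
  by_cases hne : ∃ p ∈ cylinder X v, p ∈ Function.periodicPts (shiftMap X)
  · obtain ⟨p, hp, N, hN, hpN⟩ := hne
    rcases AddSubgroup.dense_or_cyclic (returnDifferences hv hr hp) with hD | ⟨a, ha⟩
    · exact absurd (isTopologicallyMixing_of_dense hX hv hr hpos hp hN hpN hD) hmix
    · have hmem : ∀ q ∈ cylinder X v, q ∈ Function.periodicPts (shiftMap X) →
          birkhoffSum (shiftMap X) r (Function.minimalPeriod (shiftMap X) q) q ∈
            AddSubgroup.zmultiples a := by
        intro q hq hq'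
        rw [AddSubgroup.zmultiples_eq_closure, ← ha]
        exact birkhoffSum_mem_returnDifferences hv hr hp hq hN
          (Function.minimalPeriod_pos_of_mem_periodicPts hq') hpN
          (Function.isPeriodicPt_minimalPeriod _ _)
      -- The generator of a cyclic group may be negative or zero; for a zero generator all sums
      -- vanish and any `δ` serves.
      rcases lt_trichotomy a 0 with h | rfl | h
      · refine ⟨-a, neg_pos.2 h, fun q hq hq' => ?_⟩
        rw [AddSubgroup.zmultiples_neg]
        exact hmem q hq hq'
      · refine ⟨1, one_pos, fun q hq hq' => ?_⟩
        have := hmem q hq hq'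
        rw [AddSubgroup.zmultiples_zero_eq_bot, AddSubgroup.mem_bot] at this
        rw [this]
        exact zero_mem _
      · exact ⟨a, h, hmem⟩
  · exact ⟨1, one_pos, fun p hp hp' => absurd ⟨p, hp, hp'⟩ hne⟩

end Mixing

end ShiftSuspension

theorem theorem3p1 {A : Type*} [Countable A] [TopologicalSpace A] [DiscreteTopology A]
    (X : SymbolicDynamics.FullShift.Subshift A ℤ) (hX : ShiftSuspension.IsTransitive X)
    (v : List A) (hv : ShiftSuspension.IsSynchronizing X v)
    (r : X.carrier → ℝ) (hpos : ∀ x, 0 < r x) (hr : ShiftSuspension.HasWaltersProperty X r) :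
    ¬ ShiftSuspension.IsTopologicallyMixing
        (ShiftSuspension.suspensionFlow (ShiftSuspension.shiftMap X) r) ↔
      ∃ δ : ℝ, 0 < δ ∧ ∀ p ∈ ShiftSuspension.cylinder X v,
        p ∈ Function.periodicPts (ShiftSuspension.shiftMap X) →
          birkhoffSum (ShiftSuspension.shiftMap X) r
              (Function.minimalPeriod (ShiftSuspension.shiftMap X) p) p ∈
            AddSubgroup.zmultiples δ :=
  ⟨ShiftSuspension.exists_forall_mem_zmultiples_of_not_isTopologicallyMixing hX hv hr hpos,
    fun ⟨_, hδ, h⟩ =>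
      ShiftSuspension.not_isTopologicallyMixing_of_forall_mem_zmultiples hv hr hpos hδ h⟩
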